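/- Let $\mathbb{K}$ be an algebraically closed field and let $\Lambda$ be a finite-dimensional (associative, unital) $\mathbb{K}$-algebra. Write $\mathsf{Mod}(\Lambda)$ for the category of all left $\Lambda$-modules and $\mathsf{mod}(\Lambda)$ for its full subcategory of modules that are finite-dimensional over $\mathbb{K}$. For a $\Lambda$-module $M$, let $\mathsf{Gen}(M)$ (respectively $\mathsf{gen}(M)$) be the full subcategory of all quotients of arbitrary (respectively finite) coproducts of copies of $M$, and let $M^\perp$ be the full subcategory of all modules $Y$ with $\mathsf{Hom}_\Lambda(M,Y)=0$. Let $(\mathcal{T},\mathcal{F})$ be a torsion pair in $\mathsf{Mod}(\Lambda)$, that is, a pair of full subcategories closed under isomorphisms such that $\mathsf{Hom}_\Lambda(T,F)=0$ for all $T\in\mathcal{T}$ and $F\in\mathcal{F}$, and such that every $\Lambda$-module $X$ admits a short exact sequence $0\to t(X)\to X\to f(X)\to 0$ with $t(X)\in\mathcal{T}$ and $f(X)\in\mathcal{F}$. Then the following statements are equivalent. 1. There is a finite-dimensional $\Lambda$-module $M$ such that $\mathcal{T}\cap\mathsf{mod}(\Lambda)=\mathsf{gen}(M)$. 2. There is a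 finite-dimensional $\Lambda$-module $M$ such that $\mathcal{T}=\mathsf{Gen}(M)$ and $\mathcal{F}=M^\perp$. 3. $\mathcal{T}$ is closed under arbitrary products, and $\mathcal{F}$ is closed under direct limits (of direct systems indexed by nonempty directed sets). -/

import Mathlib

open CategoryTheory CategoryTheory.Limits

universe w u v

namespace TorsionModule

/-- A pair `(T, F)` of full, isomorphism-closed subcategories of an abelian category is a
torsion pair if there are no nonzero morphisms from objects of `T` to objects of `F` and every
object `X` sits in a short exact sequence `0 ⟶ tX ⟶ X ⟶ fX ⟶ 0` with `tX` in `T` and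
`fX` in `F`. -/
structure IsTorsionPair {C : Type u} [Category.{v} C] [Abelian C]
    (T F : ObjectProperty C) : Prop where
  closedUnderIso_torsion : T.IsClosedUnderIsomorphisms
  closedUnderIso_torsionFree : F.IsClosedUnderIsomorphisms
  hom_eq_zero : ∀ ⦃X Y : C⦄, T X → F Y → ∀ f : X ⟶ Y, f = 0
  exists_shortExact : ∀ X : C, ∃ (tX fX : C) (i : tX ⟶ X) (p : X ⟶ fX) (h : i ≫ p = 0),
    T tX ∧ F fX ∧ (ShortComplex.mk i p h).ShortExact

/-- The subcategory `mod(Λ)` of `Mod(Λ)`: the left `Λ`-modules that are finite-dimensional as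
vector spaces over `K`, where `K` acts through the structure map `K → Λ`. -/
def finDim (K : Type w) [Field K] (Λ : Type u) [Ring Λ] [Algebra K Λ] :
    ObjectProperty (ModuleCat.{u} Λ) :=
  fun N =>
    letI : Module K N := Module.compHom N (algebraMap K Λ)
    FiniteDimensional K N

/-- `Gen(M)`: all quotients of arbitrary (possibly infinite) coproducts of copies of `M`. -/
def bigGen {Λ : Type u} [Ring Λ] (M : ModuleCat.{u} Λ) :
    ObjectProperty (ModuleCat.{u} Λ) :=
  fun N => ∃ (ι : Type u) (f : (ι →₀ M) →ₗ[Λ] N), Function.Surjective f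

/-- `gen(M)`: all quotients of finite coproducts of copies of `M`. -/
def smallGen {Λ : Type u} [Ring Λ] (M : ModuleCat.{u} Λ) :
    ObjectProperty (ModuleCat.{u} Λ) :=
  fun N => ∃ (n : ℕ) (f : (Fin n →₀ M) →ₗ[Λ] N), Function.Surjective f

/-- `M^⊥`: all modules `Y` with `Hom(M, Y) = 0`. -/
def rightPerp {Λ : Type u} [Ring Λ] (M : ModuleCat.{u} Λ) :
    ObjectProperty (ModuleCat.{u} Λ) :=
  (ObjectProperty.singleton M).rightOrthogonal

/-- Closure under products of arbitrary small families. -/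
def ClosedUnderProducts {Λ : Type u} [Ring Λ]
    (P : ObjectProperty (ModuleCat.{u} Λ)) : Prop :=
  ∀ J : Type u, P.IsClosedUnderLimitsOfShape (Discrete J)

/-- Closure under direct limits, that is, under colimits of direct systems indexed by
nonempty (up-)directed preordered sets. -/
def ClosedUnderDirectLimits {Λ : Type u} [Ring Λ]
    (P : ObjectProperty (ModuleCat.{u} Λ)) : Prop :=
  ∀ (J : Type u) [Preorder J] [IsDirectedOrder J] [Nonempty J],
    P.IsClosedUnderColimitsOfShape J

end TorsionModule

/-! Everything runs through pointed generators: a finitely generated torsion module X₀ with an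
element x₀ that can be mapped to any element of any torsion module. Such a module generates the
torsion class, and maps out of it can be chosen coordinatewise, so products cause no trouble.

From 2, a basis of M, viewed as an element of a power of M, is a pointed generator of `bigGen M`;
closure of M^⊥ under direct limits holds because M is finitely presented. From 3, the tuple of all
elements of all finitely generated torsion modules lives in a torsion product, and direct limits
place it in a finitely generated torsion submodule, the required X₀.

The hard implication is 1 → 2, where only finitely generated torsion modules are controlled. For X₀
of minimal length, pointed endomorphisms are automorphisms. With a free cover Q of X₀ and a minimal
projective cover P of its kernel, extensions of X₀ by torsion modules split, so maps from P to
finitely generated torsion modules extend to Q (`exists_extension_of_minimal`). A duality argument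
(`exists_extension_of_finite_quotients`) carries such extension properties from finite-dimensional
quotients to arbitrary torsion modules. -/

namespace TorsionModule

/-! ### Closure properties of torsion pairs -/

section TorsionPair

variable {Λ : Type u} [Ring Λ] {T F : ObjectProperty (ModuleCat.{u} Λ)}

theorem IsTorsionPair.torsion_of_linearEquiv (h : IsTorsionPair T F) {X Y : Type u}
    [AddCommGroup X] [Module Λ X] [AddCommGroup Y] [Module Λ Y] (e : X ≃ₗ[Λ] Y)
    (hX : T (ModuleCat.of Λ X)) : T (ModuleCat.of Λ Y) :=
  h.closedUnderIso_torsion.of_iso e.toModuleIso hX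

/-- The defining exact sequence of a torsion pair, in terms of linear maps. -/
theorem IsTorsionPair.exists_exact (h : IsTorsionPair T F) (X : Type u)
    [AddCommGroup X] [Module Λ X] :
    ∃ (A B : ModuleCat.{u} Λ) (i : A →ₗ[Λ] X) (p : X →ₗ[Λ] B), T A ∧ F B ∧
      Function.Injective i ∧ Function.Surjective p ∧ LinearMap.range i = LinearMap.ker p := by
  obtain ⟨A, B, i, p, w, hA, hB, hS⟩ := h.exists_shortExact (ModuleCat.of Λ X)
  exact ⟨A, B, i.hom, p.hom, hA, hB, hS.moduleCat_injective_f, hS.moduleCat_surjective_g,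
    hS.exact.moduleCat_range_eq_ker⟩

theorem IsTorsionPair.linearMap_eq_zero (h : IsTorsionPair T F) {X Y : Type u}
    [AddCommGroup X] [Module Λ X] [AddCommGroup Y] [Module Λ Y]
    (hX : T (ModuleCat.of Λ X)) (hY : F (ModuleCat.of Λ Y)) (f : X →ₗ[Λ] Y) : f = 0 := by
  simpa using congrArg ModuleCat.Hom.hom (h.hom_eq_zero hX hY (ModuleCat.ofHom f))

theorem IsTorsionPair.torsion_iff (h : IsTorsionPair T F) (X : Type u)
    [AddCommGroup X] [Module Λ X] :
    T (ModuleCat.of Λ X) ↔ ∀ B : ModuleCat.{u} Λ, F B → ∀ f : X →ₗ[Λ] B, f = 0 := by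
  refine ⟨fun hX B hB f => h.linearMap_eq_zero hX hB f, fun H => ?_⟩
  obtain ⟨A, B, i, p, hA, hB, hi, -, hip⟩ := h.exists_exact X
  rw [H B hB p, LinearMap.ker_zero, LinearMap.range_eq_top] at hip
  exact h.torsion_of_linearEquiv (LinearEquiv.ofBijective i ⟨hi, hip⟩) hA

theorem IsTorsionPair.torsionFree_iff (h : IsTorsionPair T F) (Y : ModuleCat.{u} Λ) :
    F Y ↔ ∀ A : ModuleCat.{u} Λ, T A → ∀ f : A →ₗ[Λ] Y, f = 0 := by
  refine ⟨fun hY A hA f => h.linearMap_eq_zero hA hY f, fun H => ?_⟩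
  obtain ⟨A, B, i, p, hA, hB, -, hp, hip⟩ := h.exists_exact Y
  rw [H A hA i, LinearMap.range_zero, eq_comm, LinearMap.ker_eq_bot] at hip
  exact h.closedUnderIso_torsionFree.of_iso
    (LinearEquiv.ofBijective p ⟨hip, hp⟩).symm.toModuleIso hB

theorem IsTorsionPair.torsion_of_surjective (h : IsTorsionPair T F) {X Y : Type u}
    [AddCommGroup X] [Module Λ X] [AddCommGroup Y] [Module Λ Y]
    (hX : T (ModuleCat.of Λ X)) (f : X →ₗ[Λ] Y) (hf : Function.Surjective f) :
    T (ModuleCat.of Λ Y) := by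
  refine (h.torsion_iff Y).2 fun B hB g => ?_
  have := h.linearMap_eq_zero hX hB (g ∘ₗ f)
  rwa [← LinearMap.zero_comp f, LinearMap.cancel_right hf] at this

/-- The torsion class is closed under extensions. -/
theorem IsTorsionPair.torsion_of_extension (h : IsTorsionPair T F) {X Y Z : Type u}
    [AddCommGroup X] [Module Λ X] [AddCommGroup Y] [Module Λ Y] [AddCommGroup Z] [Module Λ Z]
    (hX : T (ModuleCat.of Λ X)) (hZ : T (ModuleCat.of Λ Z)) (f : X →ₗ[Λ] Y) (g : Y →ₗ[Λ] Z)
    (hg : Function.Surjective g) (hfg : LinearMap.ker g ≤ LinearMap.range f) :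
    T (ModuleCat.of Λ Y) := by
  refine (h.torsion_iff Y).2 fun B hB φ => ?_
  have h1 : LinearMap.ker g ≤ LinearMap.ker φ := by
    intro y hy
    obtain ⟨x, rfl⟩ := hfg hy
    exact LinearMap.congr_fun (h.linearMap_eq_zero hX hB (φ ∘ₗ f)) x
  have h2 := h.linearMap_eq_zero hZ hB
    ((LinearMap.ker g).liftQ φ h1 ∘ₗ (g.quotKerEquivOfSurjective hg).symm.toLinearMap)
  ext y
  have h3 := LinearMap.congr_fun h2 (g y)
  have h4 : (g.quotKerEquivOfSurjective hg).symm (g y) = (LinearMap.ker g).mkQ y := by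
    rw [LinearEquiv.symm_apply_eq]; rfl
  simpa [h4] using h3

theorem IsTorsionPair.torsion_finsupp (h : IsTorsionPair T F) {X : Type u}
    [AddCommGroup X] [Module Λ X] (hX : T (ModuleCat.of Λ X)) (ι : Type u) :
    T (ModuleCat.of Λ (ι →₀ X)) := by
  refine (h.torsion_iff _).2 fun B hB φ => ?_
  refine Finsupp.lhom_ext' fun i => ?_
  exact h.linearMap_eq_zero hX hB (φ ∘ₗ Finsupp.lsingle i)

theorem IsTorsionPair.bigGen_le (h : IsTorsionPair T F) {M : ModuleCat.{u} Λ} (hM : T M) :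
    bigGen M ≤ T := fun _ ⟨ι, f, hf⟩ =>
  h.torsion_of_surjective (h.torsion_finsupp hM ι) f hf

/-- A torsion pair is determined by its torsion class, so the second equality in condition 2 is
automatic. -/
theorem IsTorsionPair.eq_rightPerp (h : IsTorsionPair T F) {M : ModuleCat.{u} Λ}
    (hT : T = bigGen M) : F = rightPerp M := by
  ext Y
  rw [h.torsionFree_iff, hT]
  constructor
  · rintro H X f ⟨⟩
    have := H M ⟨PUnit, Finsupp.lapply PUnit.unit, fun m => ⟨Finsupp.single PUnit.unit m, by simp⟩⟩ f.hom
    exact ModuleCat.hom_ext this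
  · rintro H A ⟨ι, g, hg⟩ f
    have : f ∘ₗ g = 0 := by
      refine Finsupp.lhom_ext' fun i => ?_
      have := H (ModuleCat.ofHom (f ∘ₗ g ∘ₗ Finsupp.lsingle i)) ⟨PUnit.unit⟩
      simpa using congrArg ModuleCat.Hom.hom this
    rwa [← LinearMap.zero_comp g, LinearMap.cancel_right hg] at this

end TorsionPair

/-! ### Finite-dimensional and finitely generated modules -/

section FiniteDimensional

variable {K : Type w} [Field K] {Λ : Type u} [Ring Λ] [Algebra K Λ]

theorem finDim_iff [FiniteDimensional K Λ] (N : ModuleCat.{u} Λ) :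
    finDim K Λ N ↔ Module.Finite Λ N := by
  let : Module K N := Module.compHom N (algebraMap K Λ)
  have : IsScalarTower K Λ N := ⟨fun k a n => by
    rw [Algebra.smul_def, mul_smul]; rfl⟩
  constructor
  · intro h
    have : Module.Finite K N := h
    exact Module.Finite.of_restrictScalars_finite K Λ N
  · intro h
    exact Module.Finite.trans (R := K) Λ N

end FiniteDimensional

/-! ### Pointed generators and generated classes -/

section PointedGenerator

variable {Λ : Type u} [Ring Λ]

/-- `x₀ : X₀` is a pointed generator of `X` if every element of `X` is the image of `x₀` under
some homomorphism `X₀ → X`. -/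
def IsPointedGenerator {X₀ : Type u} [AddCommGroup X₀] [Module Λ X₀] (x₀ : X₀)
    (X : Type u) [AddCommGroup X] [Module Λ X] : Prop :=
  ∀ x : X, ∃ f : X₀ →ₗ[Λ] X, f x₀ = x

theorem bigGen_iff_iSup_range {M N : ModuleCat.{u} Λ} :
    bigGen M N ↔ ⨆ f : M →ₗ[Λ] N, LinearMap.range f = ⊤ := by
  constructor
  · rintro ⟨ι, g, hg⟩
    rw [eq_top_iff]
    intro n _
    obtain ⟨x, rfl⟩ := hg n
    induction x using Finsupp.induction_linear with
    | zero => simp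
    | add a b ha hb => rw [map_add]; exact add_mem (ha trivial) (hb trivial)
    | single i m =>
      exact Submodule.mem_iSup_of_mem (g ∘ₗ Finsupp.lsingle i) ⟨m, rfl⟩
  · intro h
    refine ⟨M →ₗ[Λ] N, Finsupp.lsum ℕ fun f => f, ?_⟩
    rw [← LinearMap.range_eq_top, eq_top_iff, ← h]
    refine iSup_le fun f => ?_
    rintro _ ⟨m, rfl⟩
    exact ⟨Finsupp.single f m, by simp⟩

theorem IsPointedGenerator.bigGen {X₀ X : ModuleCat.{u} Λ} {x₀ : X₀}
    (h : IsPointedGenerator (Λ := Λ) x₀ X) : bigGen X₀ X := by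
  rw [bigGen_iff_iSup_range, eq_top_iff]
  intro x _
  obtain ⟨f, rfl⟩ := h x
  exact Submodule.mem_iSup_of_mem f ⟨x₀, rfl⟩

theorem IsPointedGenerator.pi {X₀ : Type u} [AddCommGroup X₀] [Module Λ X₀] {x₀ : X₀}
    {J : Type u} {X : J → Type u} [∀ j, AddCommGroup (X j)] [∀ j, Module Λ (X j)]
    (h : ∀ j, IsPointedGenerator (Λ := Λ) x₀ (X j)) :
    IsPointedGenerator (Λ := Λ) x₀ (∀ j, X j) := by
  intro x
  choose f hf using fun j => h j (x j)
  exact ⟨LinearMap.pi f, funext hf⟩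

theorem smallGen_le_bigGen {M : ModuleCat.{u} Λ} : smallGen M ≤ bigGen M := by
  rintro N ⟨n, f, hf⟩
  exact ⟨ULift (Fin n), f ∘ₗ (Finsupp.domLCongr Equiv.ulift).toLinearMap,
    hf.comp (LinearEquiv.surjective _)⟩

/-- A finitely generated module is a compact element of its submodule lattice, so finitely many
images of M already fill N. -/
theorem smallGen_of_bigGen {M N : ModuleCat.{u} Λ} [Module.Finite Λ N] (h : bigGen M N) :
    smallGen M N := by
  rw [bigGen_iff_iSup_range] at h
  have hc := (Submodule.fg_iff_compact (⊤ : Submodule Λ N)).1 Module.Finite.fg_top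
  obtain ⟨s, hs⟩ := (CompleteLattice.isCompactElement_iff_exists_le_iSup_of_le_iSup _).1 hc _
    (fun f : M →ₗ[Λ] N => LinearMap.range f) h.ge
  refine ⟨s.card, Finsupp.lsum ℕ fun i => (s.equivFin.symm i : M →ₗ[Λ] N), ?_⟩
  rw [← LinearMap.range_eq_top, eq_top_iff]
  refine hs.trans (Finset.sup_le fun f hf => ?_)
  rintro _ ⟨m, rfl⟩
  exact ⟨Finsupp.single (s.equivFin ⟨f, hf⟩) m, by simp⟩

theorem finite_of_smallGen {M N : ModuleCat.{u} Λ} [Module.Finite Λ M] (h : smallGen M N) :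
    Module.Finite Λ N := by
  obtain ⟨n, f, hf⟩ := h
  exact Module.Finite.of_surjective f hf

/-- A finite-dimensional module `M` yields a pointed generator of all of `Gen(M)`, namely the
tuple of the members of a basis in a finite power of `M`. -/
theorem exists_isPointedGenerator (K : Type w) [Field K] [Algebra K Λ] [FiniteDimensional K Λ]
    (M : ModuleCat.{u} Λ) [Module.Finite Λ M] :
    ∃ (d : ℕ) (x₀ : Fin d → M), ∀ N : ModuleCat.{u} Λ, bigGen M N →
      IsPointedGenerator (Λ := Λ) x₀ N := by
  let : Module K M := Module.compHom M (algebraMap K Λ)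
  have smul_eq : ∀ (k : K) (m : M), k • m = algebraMap K Λ k • m := fun _ _ => rfl
  have : IsScalarTower K Λ M := ⟨fun k a n => by
    rw [Algebra.smul_def, mul_smul]; rfl⟩
  have : Module.Finite K M := Module.Finite.trans (R := K) Λ M
  let b := Module.finBasis K M
  refine ⟨_, b, fun N hN => ?_⟩
  intro x
  rw [bigGen_iff_iSup_range] at hN
  have hx : x ∈ ⨆ f : M →ₗ[Λ] N, LinearMap.range f := hN ▸ Submodule.mem_top
  induction hx using Submodule.iSup_induction' with
  | zero => exact ⟨0, rfl⟩
  | add x y _ _ hx hy =>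
    obtain ⟨f, rfl⟩ := hx
    obtain ⟨g, rfl⟩ := hy
    exact ⟨f + g, rfl⟩
  | mem f x hx =>
    obtain ⟨m, rfl⟩ := hx
    -- K is central, so its scalars act by Λ-endomorphisms; the coordinates of m thus give a
    -- Λ-linear map from the power of M to M taking the basis tuple to m.
    have hcomm : ∀ (k : K) (a : Λ) (m : M), k • a • m = a • k • m := fun k a m => by
      rw [smul_eq, smul_eq, ← mul_smul, ← mul_smul, Algebra.commutes]
    let s : K → M →ₗ[Λ] M := fun k =>
      { toFun := fun m => k • m
        map_add' := smul_add k
        map_smul' := fun a m => hcomm k a m }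
    refine ⟨f ∘ₗ ∑ i, s (b.repr m i) ∘ₗ LinearMap.proj i, ?_⟩
    have : (∑ i, s (b.repr m i) ∘ₗ LinearMap.proj (R := Λ) (φ := fun _ => (M : Type u)) i) b
        = m := by
      rw [LinearMap.sum_apply]
      exact b.sum_repr m
    rw [LinearMap.comp_apply, this]

end PointedGenerator

end TorsionModule

namespace TorsionModule

/-! ### Products in Gen(M) and direct limits in M^⊥ -/

section ProductsAndDirectLimits

variable {Λ : Type u} [Ring Λ]

/-- A homomorphism from a finitely generated module over a Noetherian ring to a directed colimit
factors through one of the members of the system. -/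
theorem exists_factorization_of_isColimit [IsNoetherianRing Λ] {J : Type u} [Preorder J]
    [IsDirectedOrder J] [Nonempty J] {G : J ⥤ ModuleCat.{u} Λ} {c : Cocone G} (hc : IsColimit c)
    {M : Type u} [AddCommGroup M] [Module Λ M] [Module.Finite Λ M] (g : M →ₗ[Λ] c.pt) :
    ∃ (j : J) (h : M →ₗ[Λ] G.obj j), (c.ι.app j).hom ∘ₗ h = g := by
  obtain ⟨n, π, hπ⟩ := Module.Finite.exists_fin' Λ M
  have hι : ∀ {i j : J} (hij : i ≤ j) (x : G.obj i),
      c.ι.app j (G.map (homOfLE hij) x) = c.ι.app i x := fun hij x =>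
    ConcreteCategory.congr_hom (c.w (homOfLE hij)) x
  have hrep : ∀ i : Fin n, ∃ (j : J) (y : G.obj j), c.ι.app j y = g (π (Pi.single i 1)) :=
    fun i => Concrete.isColimit_exists_rep G hc _
  choose j y hy using hrep
  obtain ⟨k, hk⟩ := Finite.exists_le j
  let h₀ : (Fin n → Λ) →ₗ[Λ] G.obj k :=
    (Pi.basisFun Λ (Fin n)).constr ℕ fun i => G.map (homOfLE (hk i)) (y i)
  have hh₀ : (c.ι.app k).hom ∘ₗ h₀ = g ∘ₗ π := by
    refine (Pi.basisFun Λ (Fin n)).ext fun i => ?_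
    rw [LinearMap.comp_apply, Module.Basis.constr_basis, LinearMap.comp_apply,
      Pi.basisFun_apply]
    exact (hι (hk i) (y i)).trans (hy i)
  -- Finitely many relations present M, and each of them dies at some later stage.
  obtain ⟨s, hs⟩ : (LinearMap.ker π).FG := IsNoetherian.noetherian _
  have hvanish : ∀ r : s, ∃ (l : J) (hl : k ≤ l), G.map (homOfLE hl) (h₀ r) = 0 := by
    intro r
    have hr : π r = 0 := by
      have : (r : Fin n → Λ) ∈ LinearMap.ker π := hs ▸ Submodule.subset_span r.2
      exact this
    have h1 : c.ι.app k (h₀ r) = c.ι.app k 0 := by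
      rw [map_zero]
      have := LinearMap.congr_fun hh₀ r
      rw [LinearMap.comp_apply, LinearMap.comp_apply, hr, map_zero] at this
      exact this
    obtain ⟨l, u, v, huv⟩ := Concrete.isColimit_exists_of_rep_eq G hc _ _ h1
    refine ⟨l, leOfHom u, ?_⟩
    rw [map_zero] at huv
    exact huv
  choose l hl hl0 using hvanish
  obtain ⟨m, hm⟩ := Finite.exists_le l
  obtain ⟨m', hkm, hmm⟩ := exists_ge_ge k m
  let h₁ : (Fin n → Λ) →ₗ[Λ] G.obj m' := (G.map (homOfLE hkm)).hom ∘ₗ h₀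
  have hker : LinearMap.ker π ≤ LinearMap.ker h₁ := by
    rw [← hs, Submodule.span_le]
    intro r hr
    have h2 : G.map (homOfLE hkm) = G.map (homOfLE (hl ⟨r, hr⟩)) ≫
        G.map (homOfLE ((hm ⟨r, hr⟩).trans hmm)) := by
      rw [← G.map_comp]; rfl
    change G.map (homOfLE hkm) (h₀ r) = 0
    rw [h2, ConcreteCategory.comp_apply, hl0 ⟨r, hr⟩, map_zero]
  let h₂ : M →ₗ[Λ] G.obj m' := (LinearMap.ker π).liftQ h₁ hker ∘ₗ
    (π.quotKerEquivOfSurjective hπ).symm.toLinearMap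
  have hfac : h₂ ∘ₗ π = h₁ := by
    refine LinearMap.ext fun x => ?_
    have : (π.quotKerEquivOfSurjective hπ).symm (π x) = (LinearMap.ker π).mkQ x := by
      rw [LinearEquiv.symm_apply_eq]; rfl
    change (LinearMap.ker π).liftQ h₁ hker ((π.quotKerEquivOfSurjective hπ).symm (π x)) = h₁ x
    rw [this]
    rfl
  refine ⟨m', h₂, ?_⟩
  rw [← LinearMap.cancel_right hπ, LinearMap.comp_assoc, hfac, ← hh₀]
  refine LinearMap.ext fun x => ?_
  exact hι hkm (h₀ x)

theorem closedUnderDirectLimits_rightPerp [IsNoetherianRing Λ] (M : ModuleCat.{u} Λ)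
    [Module.Finite Λ M] : ClosedUnderDirectLimits (rightPerp M) := by
  intro J _ _ _
  have : (rightPerp M).IsClosedUnderIsomorphisms := by unfold rightPerp; infer_instance
  constructor
  rintro X ⟨p⟩
  rintro _ f ⟨⟨⟩⟩
  obtain ⟨j, h, hh⟩ := exists_factorization_of_isColimit p.isColimit f.hom
  have h0 := p.prop_diag_obj j (ModuleCat.ofHom h) ⟨PUnit.unit⟩
  refine ModuleCat.hom_ext ?_
  rw [← hh, show h = 0 from congrArg ModuleCat.Hom.hom h0, LinearMap.comp_zero]
  rfl

theorem closedUnderProducts_iff {P : ObjectProperty (ModuleCat.{u} Λ)}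
    [P.IsClosedUnderIsomorphisms] :
    ClosedUnderProducts P ↔ ∀ (J : Type u) (X : J → ModuleCat.{u} Λ), (∀ j, P (X j)) →
      P (ModuleCat.of Λ (∀ j, X j)) := by
  constructor
  · intro h J X hX
    have := h J
    exact P.prop_of_isLimit (ModuleCat.productConeIsLimit X) fun j => hX j.as
  · intro h J
    constructor
    rintro Y ⟨p⟩
    let X : J → ModuleCat.{u} Λ := fun j => p.diag.obj ⟨j⟩
    have h1 := h J X fun j => p.prop_diag_obj _
    have e : p.diag ≅ Discrete.functor X := Discrete.natIso fun j => Iso.refl _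
    exact P.prop_of_iso (IsLimit.conePointsIsoOfNatIso (ModuleCat.productConeIsLimit X)
      p.isLimit e.symm) h1

theorem closedUnderProducts_bigGen (K : Type w) [Field K] [Algebra K Λ] [FiniteDimensional K Λ]
    (M : ModuleCat.{u} Λ) [Module.Finite Λ M] [(bigGen M).IsClosedUnderIsomorphisms] :
    ClosedUnderProducts (bigGen M) := by
  rw [closedUnderProducts_iff]
  intro J X hX
  obtain ⟨d, x₀, hx₀⟩ := exists_isPointedGenerator K M
  have hpi : IsPointedGenerator (Λ := Λ) x₀ (∀ j, X j) :=
    IsPointedGenerator.pi fun j => hx₀ _ (hX j)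
  rw [bigGen_iff_iSup_range, eq_top_iff]
  intro x _
  obtain ⟨f, rfl⟩ := hpi x
  rw [← Finset.univ_sum_single x₀, map_sum]
  exact sum_mem fun i _ => Submodule.mem_iSup_of_mem
    (f ∘ₗ LinearMap.single Λ (fun _ => (M : Type u)) i) ⟨x₀ i, rfl⟩

end ProductsAndDirectLimits

/-! ### The torsion radical; constructing a pointed generator from condition 3 -/

section Radical

variable {Λ : Type u} [Ring Λ] {T F : ObjectProperty (ModuleCat.{u} Λ)}

/-- The largest torsion submodule, defined as the sum of all torsion submodules. -/
def torsionRadical (T : ObjectProperty (ModuleCat.{u} Λ)) (X : Type u) [AddCommGroup X]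
    [Module Λ X] : Submodule Λ X :=
  sSup {N | T (ModuleCat.of Λ N)}

/-- Functoriality of the radical, needed to make the quotients N/tN a directed system. -/
theorem IsTorsionPair.torsionRadical_le_comap (h : IsTorsionPair T F) {X Y : Type u}
    [AddCommGroup X] [Module Λ X] [AddCommGroup Y] [Module Λ Y] (f : X →ₗ[Λ] Y) :
    torsionRadical T X ≤ (torsionRadical T Y).comap f := by
  refine sSup_le fun N hN => Submodule.map_le_iff_le_comap.1 (le_sSup ?_)
  have hmem : ∀ x : N, (f ∘ₗ N.subtype) x ∈ N.map f := fun x => ⟨x, x.2, rfl⟩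
  refine h.torsion_of_surjective hN ((f ∘ₗ N.subtype).codRestrict (N.map f) hmem) ?_
  rintro ⟨_, x, hx, rfl⟩
  exact ⟨⟨x, hx⟩, rfl⟩

theorem IsTorsionPair.torsionRadical_spec (h : IsTorsionPair T F) (X : Type u)
    [AddCommGroup X] [Module Λ X] :
    T (ModuleCat.of Λ (torsionRadical T X)) ∧
      F (ModuleCat.of Λ (X ⧸ torsionRadical T X)) := by
  obtain ⟨A, B, i, p, hA, hB, hi, hp, hip⟩ := h.exists_exact X
  have hR : T (ModuleCat.of Λ (LinearMap.range i)) :=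
    h.torsion_of_linearEquiv (LinearEquiv.ofInjective i hi) hA
  have heq : torsionRadical T X = LinearMap.range i := by
    refine le_antisymm (sSup_le fun N hN => ?_) (le_sSup hR)
    rw [hip]
    intro x hx
    exact LinearMap.congr_fun (h.linearMap_eq_zero hN hB (p ∘ₗ N.subtype)) ⟨x, hx⟩
  refine ⟨heq ▸ hR, ?_⟩
  rw [heq, hip]
  exact h.closedUnderIso_torsionFree.of_iso
    (p.quotKerEquivOfSurjective hp).symm.toModuleIso hB

/-- If the torsion-free class is closed under direct limits, then every torsion module is the
union of its finitely generated torsion submodules. -/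
theorem IsTorsionPair.exists_fg_torsion_submodule [IsNoetherianRing Λ] (h : IsTorsionPair T F)
    (hF : ClosedUnderDirectLimits F) {X : Type u} [AddCommGroup X] [Module Λ X]
    (hX : T (ModuleCat.of Λ X)) (x : X) :
    ∃ N : Submodule Λ X, N.FG ∧ T (ModuleCat.of Λ N) ∧ x ∈ N := by
  classical
  let J := {N : Submodule Λ X // N.FG}
  let Q : J → Type u := fun N => N.1 ⧸ torsionRadical T N.1
  let q : ∀ N₁ N₂ : J, N₁ ≤ N₂ → Q N₁ →ₗ[Λ] Q N₂ := fun N₁ N₂ le =>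
    Submodule.mapQ _ _ (Submodule.inclusion le) (h.torsionRadical_le_comap _)
  have : DirectedSystem Q (q · · ·) :=
    { map_self := by
        intro N y
        obtain ⟨y, rfl⟩ := Submodule.mkQ_surjective _ y
        rfl
      map_map := by
        intro N₁ N₂ N₃ h₁ h₂ y
        obtain ⟨y, rfl⟩ := Submodule.mkQ_surjective _ y
        rfl }
  have : Nonempty J := ⟨⟨⊥, Submodule.fg_bot⟩⟩
  have hD : F (ModuleCat.of Λ (Module.DirectLimit Q q)) := by
    have := hF J
    exact F.prop_of_isColimit (ModuleCat.directLimitIsColimit Q q)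
      fun N => (h.torsionRadical_spec N.1).2
  let m : Module.DirectLimit _ (Module.fgSystem Λ X) →ₗ[Λ] Module.DirectLimit Q q :=
    Module.DirectLimit.map (fun N => (torsionRadical T N.1).mkQ) fun N₁ N₂ le => rfl
  -- X is the direct limit of its finitely generated submodules N, and the limit of the N/tN is
  -- torsion-free, so the comparison map vanishes. Hence x dies in some N/tN, that is, x ∈ tN.
  have hm := h.linearMap_eq_zero hX hD
    (m ∘ₗ (Module.fgSystem.equiv Λ X).symm.toLinearMap)
  let N₀ : J := ⟨Submodule.span Λ {x}, Submodule.fg_span_singleton x⟩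
  let x' : N₀.1 := ⟨x, Submodule.mem_span_singleton_self x⟩
  have hx : (Module.fgSystem.equiv Λ X).symm x = Module.DirectLimit.of _ _ _ _ N₀ x' := by
    rw [LinearEquiv.symm_apply_eq]
    exact (LinearMap.congr_fun (Module.fgSystem.equiv_comp_of N₀) x').symm
  have hx0 : Module.DirectLimit.of Λ J Q q N₀ ((torsionRadical T N₀.1).mkQ x') = 0 := by
    have := LinearMap.congr_fun hm x
    rw [LinearMap.comp_apply, LinearEquiv.coe_coe, hx] at this
    exact (Module.DirectLimit.map_apply_of _ _ _).symm.trans this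
  obtain ⟨N, hN, hxN⟩ := Module.DirectLimit.of.zero_exact hx0
  have hmem : Submodule.inclusion hN x' ∈ torsionRadical T N.1 := by
    rw [← Submodule.ker_mkQ (torsionRadical T N.1)]
    exact hxN
  refine ⟨(torsionRadical T N.1).map N.1.subtype, ?_, ?_, ⟨_, hmem, rfl⟩⟩
  · have : IsNoetherian Λ N.1 := isNoetherian_of_fg_of_noetherian _ N.2
    exact (IsNoetherian.noetherian _).map _
  · exact h.torsion_of_linearEquiv
      (Submodule.equivMapOfInjective _ N.1.injective_subtype _) (h.torsionRadical_spec N.1).1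

theorem IsTorsionPair.isPointedGenerator_of_finite [IsNoetherianRing Λ] (h : IsTorsionPair T F)
    (hF : ClosedUnderDirectLimits F) {X₀ : Type u} [AddCommGroup X₀] [Module Λ X₀] {x₀ : X₀}
    (hx₀ : ∀ X : ModuleCat.{u} Λ, Module.Finite Λ X → T X → IsPointedGenerator (Λ := Λ) x₀ X)
    {X : ModuleCat.{u} Λ} (hX : T X) : IsPointedGenerator (Λ := Λ) x₀ X := by
  intro x
  obtain ⟨N, hN, hNT, hxN⟩ := h.exists_fg_torsion_submodule hF hX x
  obtain ⟨f, hf⟩ := hx₀ (ModuleCat.of Λ N) (Module.Finite.iff_fg.2 hN) hNT ⟨x, hxN⟩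
  exact ⟨N.subtype ∘ₗ f, by simp [hf]⟩

/-- If the torsion class is closed under products and the torsion-free class under direct limits,
then the finitely generated torsion modules have a finitely generated torsion module as a
pointed generator. -/
theorem IsTorsionPair.exists_fg_isPointedGenerator [IsNoetherianRing Λ]
    (h : IsTorsionPair T F) (hT : ClosedUnderProducts T) (hF : ClosedUnderDirectLimits F) :
    ∃ (X₀ : ModuleCat.{u} Λ) (x₀ : X₀), Module.Finite Λ X₀ ∧ T X₀ ∧
      ∀ X : ModuleCat.{u} Λ, T X → IsPointedGenerator (Λ := Λ) x₀ X := by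
  have := h.closedUnderIso_torsion
  rw [closedUnderProducts_iff] at hT
  -- Quotients of the Λ^n represent all finitely generated modules by a small set. The product over
  -- `J` has one factor for each element of each torsion quotient, and x is the tautological tuple.
  let I := Σ n : ULift.{u} ℕ,
    {L : Submodule Λ (Fin n.down → Λ) // T (ModuleCat.of Λ ((Fin n.down → Λ) ⧸ L))}
  let J := Σ i : I, ((Fin i.1.down → Λ) ⧸ i.2.1)
  let X : J → ModuleCat.{u} Λ := fun j => ModuleCat.of Λ ((Fin j.1.1.down → Λ) ⧸ j.1.2.1)
  have hX := hT J X fun j => j.1.2.2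
  let x : ∀ j, X j := fun j => j.2
  obtain ⟨N, hN, hNT, hxN⟩ := h.exists_fg_torsion_submodule hF hX x
  refine ⟨ModuleCat.of Λ N, ⟨x, hxN⟩, Module.Finite.iff_fg.2 hN, hNT, fun Y hY => ?_⟩
  refine h.isPointedGenerator_of_finite hF (fun Y hYf hY y => ?_) hY
  obtain ⟨n, π, hπ⟩ := Module.Finite.exists_fin' Λ Y
  let e := π.quotKerEquivOfSurjective hπ
  let j : J := ⟨⟨⟨n⟩, ⟨LinearMap.ker π, h.torsion_of_linearEquiv e.symm hY⟩⟩, e.symm y⟩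
  let g : N →ₗ[Λ] ((Fin n → Λ) ⧸ LinearMap.ker π) :=
    LinearMap.proj (R := Λ) (φ := fun j => (X j : Type u)) j ∘ₗ N.subtype
  exact ⟨e.toLinearMap ∘ₗ g, e.apply_symm_apply y⟩

end Radical

end TorsionModule

namespace TorsionModule

/-! ### Minimal projective covers and minimal pointed generators -/

section Minimality

variable {Λ : Type u} [Ring Λ]

/-- Over an Artinian ring, every finitely generated module is covered by a finitely generated
projective module that is minimal: endomorphisms over the base are automorphisms. -/
theorem exists_minimal_projective_cover [IsArtinianRing Λ] (Ω : Type u) [AddCommGroup Ω]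
    [Module Λ Ω] [Module.Finite Λ Ω] :
    ∃ (P : ModuleCat.{u} Λ) (π : P →ₗ[Λ] Ω), Module.Finite Λ P ∧ Module.Projective Λ P ∧
      Function.Surjective π ∧ ∀ w : P →ₗ[Λ] P, π ∘ₗ w = π → Function.Bijective w := by
  let S : Set ℕ∞ := {l | ∃ (P : ModuleCat.{u} Λ) (π : P →ₗ[Λ] Ω), Module.Finite Λ P ∧
    Module.Projective Λ P ∧ Function.Surjective π ∧ Module.length Λ P = l}
  have hS : S.Nonempty := by
    obtain ⟨n, π, hπ⟩ := Module.Finite.exists_fin' Λ Ω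
    exact ⟨_, ModuleCat.of Λ (Fin n → Λ), π, inferInstanceAs (Module.Finite Λ (Fin n → Λ)),
      inferInstanceAs (Module.Projective Λ (Fin n → Λ)), hπ, rfl⟩
  obtain ⟨l, ⟨P, π, hfin, hproj, hπ, hl⟩, hmin⟩ := wellFounded_lt.has_min S hS
  refine ⟨P, π, hfin, hproj, hπ, fun w hw => ?_⟩
  have hpow : ∀ n : ℕ, π ∘ₗ (w ^ n) = π := by
    intro n
    induction n with
    | zero => rfl
    | succ n ih => rw [pow_succ', Module.End.mul_eq_comp, ← LinearMap.comp_assoc, hw, ih]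
  -- Fitting decomposition: the range of w^n is a direct summand of P, hence projective, and still
  -- covers Ω. Taking n ≥ 1 lets surjectivity of w^n pass to w.
  obtain ⟨n, hn, hn1⟩ :=
    ((LinearMap.eventually_isCompl_ker_pow_range_pow w).and
      (Filter.eventually_ge_atTop 1)).exists
  let R := LinearMap.range (w ^ n)
  have hR : Module.Projective Λ R :=
    Module.Projective.of_split R.subtype (R.projectionOnto _ hn.symm)
      (Submodule.projectionOnto_comp_subtype hn.symm)
  have htop : R = ⊤ := by
    by_contra hne
    refine hmin (Module.length Λ R) ⟨ModuleCat.of Λ R, π ∘ₗ R.subtype,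
      inferInstanceAs (Module.Finite Λ R), hR, fun y => ?_, rfl⟩ ?_
    · obtain ⟨x, rfl⟩ := hπ y
      exact ⟨⟨(w ^ n) x, x, rfl⟩, LinearMap.congr_fun (hpow n) x⟩
    · rw [← hl]
      exact Submodule.length_lt hne
  refine IsNoetherian.bijective_of_surjective_endomorphism w fun y => ?_
  obtain ⟨x, hx⟩ : y ∈ R := htop ▸ Submodule.mem_top
  refine ⟨(w ^ (n - 1)) x, ?_⟩
  rw [← hx, ← Module.End.mul_apply, ← pow_succ', Nat.sub_add_cancel hn1]

variable {T F : ObjectProperty (ModuleCat.{u} Λ)}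

/-- A pointed generator of all finitely generated torsion modules may be chosen minimal:
its pointed endomorphisms are automorphisms. -/
theorem IsTorsionPair.exists_minimal_isPointedGenerator [IsArtinianRing Λ]
    (h : IsTorsionPair T F)
    (H : ∃ (X₀ : ModuleCat.{u} Λ) (x₀ : X₀), Module.Finite Λ X₀ ∧ T X₀ ∧
      ∀ X : ModuleCat.{u} Λ, Module.Finite Λ X → T X → IsPointedGenerator (Λ := Λ) x₀ X) :
    ∃ (X₀ : ModuleCat.{u} Λ) (x₀ : X₀), Module.Finite Λ X₀ ∧ T X₀ ∧
      (∀ X : ModuleCat.{u} Λ, Module.Finite Λ X → T X → IsPointedGenerator (Λ := Λ) x₀ X) ∧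
      ∀ w : X₀ →ₗ[Λ] X₀, w x₀ = x₀ → Function.Bijective w := by
  let S : Set ℕ∞ := {l | ∃ (X₀ : ModuleCat.{u} Λ) (x₀ : X₀), Module.Finite Λ X₀ ∧ T X₀ ∧
    (∀ X : ModuleCat.{u} Λ, Module.Finite Λ X → T X → IsPointedGenerator (Λ := Λ) x₀ X) ∧
    Module.length Λ X₀ = l}
  have hS : S.Nonempty := by
    obtain ⟨X₀, x₀, h1, h2, h3⟩ := H
    exact ⟨_, X₀, x₀, h1, h2, h3, rfl⟩
  obtain ⟨l, ⟨X₀, x₀, hfin, hX₀, hgen, hl⟩, hmin⟩ := wellFounded_lt.has_min S hS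
  refine ⟨X₀, x₀, hfin, hX₀, hgen, fun w hw => ?_⟩
  refine IsNoetherian.bijective_of_surjective_endomorphism w ?_
  rw [← LinearMap.range_eq_top]
  by_contra hne
  -- The range of w contains x₀ = w x₀, so restricting maps to it gives a shorter pointed generator.
  refine hmin (Module.length Λ (LinearMap.range w)) ⟨ModuleCat.of Λ (LinearMap.range w),
    ⟨x₀, x₀, hw⟩, inferInstanceAs (Module.Finite Λ (LinearMap.range w)),
    h.torsion_of_surjective hX₀ w.rangeRestrict w.surjective_rangeRestrict,
    fun X hX hXT x => ?_, rfl⟩ ?_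
  · obtain ⟨f, hf⟩ := hgen X hX hXT x
    exact ⟨f ∘ₗ (LinearMap.range w).subtype, hf⟩
  · rw [← hl]
    exact Submodule.length_lt hne

end Minimality

/-! ### Extending maps along the presentation; from finitely generated to all torsion modules -/

section Extension

variable {Λ : Type u} [Ring Λ]

/-- If all homomorphisms from `P` to the finite-dimensional quotients of `Y` extend along
`σ : P → Q`, then so do the homomorphisms from `P` to `Y`. -/
theorem exists_extension_of_finite_quotients (K : Type w) [Field K] [Algebra K Λ]
    [FiniteDimensional K Λ] {P Q Y : Type u} [AddCommGroup P] [Module Λ P] [AddCommGroup Q]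
    [Module Λ Q] [AddCommGroup Y] [Module Λ Y] [Module.Finite Λ P] [Module.Projective Λ Q]
    (σ : P →ₗ[Λ] Q)
    (h : ∀ Y₀ : Submodule Λ Y, Module.Finite Λ (Y ⧸ Y₀) → ∀ a : P →ₗ[Λ] Y ⧸ Y₀,
      ∃ b : Q →ₗ[Λ] Y ⧸ Y₀, b ∘ₗ σ = a)
    (a : P →ₗ[Λ] Y) : ∃ b : Q →ₗ[Λ] Y, b ∘ₗ σ = a := by
  let : Module K Y := Module.compHom Y (algebraMap K Λ)
  have : IsScalarTower K Λ Y := ⟨fun k r y => by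
    rw [Algebra.smul_def, mul_smul]; rfl⟩
  have : SMulCommClass Λ K Y := IsScalarTower.to_smulCommClass'
  obtain ⟨n, f, hf⟩ := Module.Finite.exists_fin' Λ P
  let e : Fin n → P := fun i => f (Pi.single i 1)
  have he : ∀ {a b : P →ₗ[Λ] Y}, (∀ i, a (e i) = b (e i)) → a = b := by
    intro a b hab
    rw [← LinearMap.cancel_right hf]
    refine (Pi.basisFun Λ (Fin n)).ext fun i => ?_
    rw [Pi.basisFun_apply]
    exact hab i
  let restr : (Q →ₗ[Λ] Y) →ₗ[K] (Fin n → Y) :=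
    { toFun := fun b i => b (σ (e i))
      map_add' := fun _ _ => rfl
      map_smul' := fun _ _ => rfl }
  by_contra hne
  have hnot : (fun i => a (e i)) ∉ LinearMap.range restr := by
    rintro ⟨b, hb⟩
    exact hne ⟨b, he fun i => congrFun hb i⟩
  -- A functional ψ that kills all restrictions from Q but not a. Below, `Y₀` is the largest
  -- submodule whose n-th power is killed by ψ one coordinate at a time; it has finite codimension
  -- because θ takes values in n copies of the dual of Λ.
  obtain ⟨ψ, hψa, hψ⟩ := Submodule.exists_le_ker_of_notMem hnot
  let θ : Y →ₗ[K] (Fin n → Λ →ₗ[K] K) := LinearMap.pi fun i =>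
    { toFun := fun y => ψ ∘ₗ LinearMap.single K (fun _ => Y) i ∘ₗ
        (LinearMap.toSpanSingleton Λ Y y).restrictScalars K
      map_add' := fun y z => by
        ext r
        simp [smul_add, Pi.single_add]
      map_smul' := fun k y => by
        ext r
        simp [smul_comm r k y, Pi.single_smul] }
  have hθ : ∀ y i r, θ y i r = ψ (Pi.single i (r • y)) := fun y i r => rfl
  let Y₀ : Submodule Λ Y :=
    { carrier := {y | θ y = 0}
      add_mem' := fun {y z} hy hz => by
        change θ (y + z) = 0
        rw [map_add, show θ y = 0 from hy, show θ z = 0 from hz, add_zero]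
      zero_mem' := map_zero θ
      smul_mem' := fun r y hy => by
        change θ (r • y) = 0
        ext i s
        rw [hθ, ← mul_smul, ← hθ, show θ y = 0 from hy]
        rfl }
  have hfin : Module.Finite Λ (Y ⧸ Y₀) := by
    have h1 : Module.Finite K (Y ⧸ LinearMap.ker θ) :=
      Module.Finite.equiv θ.quotKerEquivRange.symm
    have h2 : Module.Finite K (Y ⧸ Y₀) :=
      Module.Finite.of_surjective
        ((LinearMap.ker θ).liftQ (Y₀.mkQ.restrictScalars K) fun y hy =>
          (Submodule.Quotient.mk_eq_zero Y₀).2 hy)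
        fun z => by
          obtain ⟨y, rfl⟩ := Y₀.mkQ_surjective z
          exact ⟨(LinearMap.ker θ).mkQ y, rfl⟩
    exact Module.Finite.of_restrictScalars_finite K Λ _
  obtain ⟨b, hb⟩ := h Y₀ hfin (Y₀.mkQ ∘ₗ a)
  -- The lift b' restricts to a modulo Y₀, which ψ cannot see; so ψ would kill a too.
  obtain ⟨b', hb'⟩ := Module.projective_lifting_property Y₀.mkQ b Y₀.mkQ_surjective
  have hmem : ∀ p, a p - b' (σ p) ∈ Y₀ := by
    intro p
    rw [← Submodule.ker_mkQ Y₀, LinearMap.mem_ker, map_sub, sub_eq_zero]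
    have h1 := LinearMap.congr_fun hb p
    rw [← hb'] at h1
    exact h1.symm
  have hzero : ∀ y : Fin n → Y, (∀ i, y i ∈ Y₀) → ψ y = 0 := by
    intro y hy
    rw [← Finset.univ_sum_single y, map_sum]
    refine Finset.sum_eq_zero fun i _ => ?_
    rw [← one_smul Λ (y i), ← hθ, show θ (y i) = 0 from hy i]
    rfl
  refine hψa ?_
  have h1 : ψ (restr b') = 0 := hψ ⟨b', rfl⟩
  have h2 := hzero ((fun i => a (e i)) - restr b') fun i => hmem (e i)
  rwa [map_sub, h1, sub_zero] at h2

variable {T F : ObjectProperty (ModuleCat.{u} Λ)}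

/-- Let `x₀ : X₀` be a minimal pointed generator of the finitely generated torsion modules. In a
presentation of `X₀` whose first syzygy has the minimal cover `P`, homomorphisms from `P` to
finitely generated torsion modules extend to the projective cover `Q` of `X₀`. -/
theorem IsTorsionPair.exists_extension_of_minimal (h : IsTorsionPair T F)
    {X₀ : ModuleCat.{u} Λ} {x₀ : X₀} (hX₀ : T X₀)
    (hgen : ∀ X : ModuleCat.{u} Λ, Module.Finite Λ X → T X → IsPointedGenerator (Λ := Λ) x₀ X)
    (hmin : ∀ w : X₀ →ₗ[Λ] X₀, w x₀ = x₀ → Function.Bijective w)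
    {P Q : Type u} [AddCommGroup P] [Module Λ P] [AddCommGroup Q] [Module Λ Q]
    [Module.Projective Λ P] [Module.Projective Λ Q] [Module.Finite Λ Q]
    (π : Q →ₗ[Λ] X₀) (hπ : Function.Surjective π)
    (σ : P →ₗ[Λ] Q) (hσ : LinearMap.range σ = LinearMap.ker π)
    (hσmin : ∀ w : P →ₗ[Λ] P, σ ∘ₗ w = σ → Function.Bijective w)
    {X : Type u} [AddCommGroup X] [Module Λ X] [Module.Finite Λ X] (hX : T (ModuleCat.of Λ X))
    (a : P →ₗ[Λ] X) : ∃ c : Q →ₗ[Λ] X, c ∘ₗ σ = a := by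
  -- The quotient by N is the pushout of a and σ. Since σ need not be injective, j has kernel a(ker
  -- σ).
  let N : Submodule Λ (X × Q) := LinearMap.range (a.prod (-σ))
  let j : X →ₗ[Λ] (X × Q) ⧸ N := N.mkQ ∘ₗ LinearMap.inl Λ X Q
  let k : Q →ₗ[Λ] (X × Q) ⧸ N := N.mkQ ∘ₗ LinearMap.inr Λ X Q
  have hπσ : ∀ v, π (σ v) = 0 := fun v => by
    have : σ v ∈ LinearMap.ker π := hσ ▸ ⟨v, rfl⟩
    exact this
  have hN : N ≤ LinearMap.ker (π ∘ₗ LinearMap.snd Λ X Q) := by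
    rintro _ ⟨v, rfl⟩
    simp [hπσ]
  let p : ((X × Q) ⧸ N) →ₗ[Λ] X₀ := N.liftQ (π ∘ₗ LinearMap.snd Λ X Q) hN
  have hpk : ∀ q, p (k q) = π q := fun q => rfl
  have hjk : ∀ v, j (a v) = k (σ v) := by
    intro v
    refine (Submodule.Quotient.eq N).2 ⟨v, ?_⟩
    simp
  have hkerp : LinearMap.ker p ≤ LinearMap.range j := by
    intro z hz
    obtain ⟨⟨x, q⟩, rfl⟩ := N.mkQ_surjective z
    have hq : q ∈ LinearMap.range σ := by
      rw [hσ]; exact hz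
    obtain ⟨v, rfl⟩ := hq
    refine ⟨x + a v, ?_⟩
    rw [map_add, hjk]
    change N.mkQ (x, 0) + N.mkQ (0, σ v) = N.mkQ (x, σ v)
    rw [← map_add]
    simp
  have hp : Function.Surjective p := fun y => by
    obtain ⟨q, rfl⟩ := hπ y
    exact ⟨k q, rfl⟩
  have hE : T (ModuleCat.of Λ ((X × Q) ⧸ N)) := h.torsion_of_extension hX hX₀ j p hp hkerp
  obtain ⟨e, he⟩ := hp x₀
  obtain ⟨f, hf⟩ := hgen (ModuleCat.of Λ ((X × Q) ⧸ N))
    (inferInstanceAs (Module.Finite Λ ((X × Q) ⧸ N))) hE e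
  -- f sends x₀ to a lift of x₀, so p ∘ f is a pointed endomorphism; minimality of X₀ splits p.
  have hbij : Function.Bijective (p ∘ₗ f) := hmin (p ∘ₗ f) (by
    rw [LinearMap.comp_apply, hf, he])
  let s : X₀ →ₗ[Λ] (X × Q) ⧸ N :=
    f ∘ₗ (LinearEquiv.ofBijective (p ∘ₗ f) hbij).symm.toLinearMap
  have hs : ∀ y, p (s y) = y := fun y =>
    (LinearEquiv.ofBijective (p ∘ₗ f) hbij).apply_symm_apply y
  have hrange : ∀ q, (k - s ∘ₗ π) q ∈ LinearMap.range j := by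
    intro q
    refine hkerp ?_
    rw [LinearMap.mem_ker, LinearMap.sub_apply, map_sub, hpk, LinearMap.comp_apply, hs, sub_self]
  obtain ⟨c, hc⟩ := Module.projective_lifting_property j.rangeRestrict
    ((k - s ∘ₗ π).codRestrict _ hrange) j.surjective_rangeRestrict
  have hc' : ∀ q, j (c q) = k q - s (π q) := fun q =>
    congrArg Subtype.val (LinearMap.congr_fun hc q)
  -- The splitting yields c extending a only up to an error in a(ker σ). As P is projective, the
  -- error is a ∘ u with u : P → ker σ. Then w = id - u satisfies σw = σ and aw = cσ = cσw, and
  -- minimality of P allows w to be cancelled.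
  have hdiff : ∀ v, (a - c ∘ₗ σ) v ∈ LinearMap.range (a ∘ₗ (LinearMap.ker σ).subtype) := by
    intro v
    have h1 : j (a v - c (σ v)) = 0 := by
      rw [map_sub, hjk, hc', hπσ, map_zero, sub_zero, sub_self]
    obtain ⟨u, hu⟩ := (Submodule.Quotient.mk_eq_zero N).1 h1
    have hu1 : a u = a v - c (σ v) := congrArg Prod.fst hu
    have hu2 : -σ u = 0 := congrArg Prod.snd hu
    exact ⟨⟨u, neg_eq_zero.1 hu2⟩, hu1⟩
  obtain ⟨u, hu⟩ := Module.projective_lifting_property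
    (a ∘ₗ (LinearMap.ker σ).subtype).rangeRestrict ((a - c ∘ₗ σ).codRestrict _ hdiff)
    (LinearMap.surjective_rangeRestrict _)
  have hu' : ∀ v, a (u v) = a v - c (σ v) := fun v =>
    congrArg Subtype.val (LinearMap.congr_fun hu v)
  let w : P →ₗ[Λ] P := LinearMap.id - (LinearMap.ker σ).subtype ∘ₗ u
  have hw : ∀ v, σ (w v) = σ v := by
    intro v
    have : σ (u v) = 0 := (u v).2
    simp [w, this]
  have haw : ∀ v, a (w v) = c (σ v) := by
    intro v
    simp [w, hu']
  refine ⟨c, LinearMap.ext fun v => ?_⟩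
  obtain ⟨v, rfl⟩ := (hσmin w (LinearMap.ext hw)).2 v
  rw [haw, LinearMap.comp_apply, hw]

/-- A minimal pointed generator of the finitely generated torsion modules is a pointed generator
of all torsion modules. -/
theorem IsTorsionPair.isPointedGenerator_of_minimal (K : Type w) [Field K] [Algebra K Λ]
    [FiniteDimensional K Λ] [IsArtinianRing Λ] (h : IsTorsionPair T F)
    {X₀ : ModuleCat.{u} Λ} {x₀ : X₀} [Module.Finite Λ X₀] (hX₀ : T X₀)
    (hgen : ∀ X : ModuleCat.{u} Λ, Module.Finite Λ X → T X → IsPointedGenerator (Λ := Λ) x₀ X)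
    (hmin : ∀ w : X₀ →ₗ[Λ] X₀, w x₀ = x₀ → Function.Bijective w)
    {X : ModuleCat.{u} Λ} (hX : T X) : IsPointedGenerator (Λ := Λ) x₀ X := by
  obtain ⟨n, π, hπ⟩ := Module.Finite.exists_fin' Λ X₀
  obtain ⟨P, ρ, hPfin, hPproj, hρ, hρmin⟩ :=
    exists_minimal_projective_cover (Λ := Λ) (LinearMap.ker π)
  let σ : P →ₗ[Λ] (Fin n → Λ) := (LinearMap.ker π).subtype ∘ₗ ρ
  have hσ : LinearMap.range σ = LinearMap.ker π := by
    rw [LinearMap.range_comp, LinearMap.range_eq_top.2 hρ, Submodule.map_top,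
      Submodule.range_subtype]
  have hσmin : ∀ w : P →ₗ[Λ] P, σ ∘ₗ w = σ → Function.Bijective w := fun w hw =>
    hρmin w (LinearMap.ext fun v => Subtype.ext (LinearMap.congr_fun hw v))
  obtain ⟨q₀, hq₀⟩ := hπ x₀
  -- The factor Λ records the value at q₀: extending (r, v) ↦ r • x along τ means finding a map on
  -- Λ^n that kills ker π and sends q₀ to x, that is, a map X₀ → X with x₀ ↦ x.
  let τ : (Λ × P) →ₗ[Λ] (Fin n → Λ) := (LinearMap.toSpanSingleton Λ _ q₀).coprod σ
  have hτ : ∀ r v, τ (r, v) = r • q₀ + σ v := fun r v => rfl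
  have hπσ : ∀ v, π (σ v) = 0 := fun v => (ρ v).2
  intro x
  obtain ⟨b, hb⟩ := exists_extension_of_finite_quotients K τ (Y := X) (fun Y₀ hY₀ a => by
    have hT : T (ModuleCat.of Λ (X ⧸ Y₀)) := h.torsion_of_surjective hX Y₀.mkQ Y₀.mkQ_surjective
    obtain ⟨c, hc⟩ := h.exists_extension_of_minimal hX₀ hgen hmin π hπ σ hσ hσmin hT
      (a ∘ₗ LinearMap.inr Λ Λ P)
    obtain ⟨d, hd⟩ := hgen (ModuleCat.of Λ (X ⧸ Y₀)) hY₀ hT (a (1, 0) - c q₀)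
    have hc' : ∀ v, c (σ v) = a (0, v) := fun v => LinearMap.congr_fun hc v
    -- c has the right values on P; d ∘ π corrects the value at q₀ without disturbing them, since πσ
    -- = 0.
    refine ⟨c + d ∘ₗ π, LinearMap.prod_ext (LinearMap.ext_ring ?_) (LinearMap.ext fun v => ?_)⟩
    · simp only [LinearMap.comp_apply, LinearMap.inl_apply, LinearMap.add_apply, hτ, one_smul,
        map_zero, add_zero, hq₀]
      exact (congrArg (c q₀ + ·) hd).trans (add_sub_cancel _ _)
    · simp only [LinearMap.comp_apply, LinearMap.inr_apply, LinearMap.add_apply, hτ, zero_smul,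
        zero_add, hπσ, map_zero, add_zero, hc'])
    ((LinearMap.toSpanSingleton Λ X x).coprod 0)
  have hb' : ∀ r v, b (r • q₀ + σ v) = r • x := fun r v =>
    (LinearMap.congr_fun hb (r, v)).trans (by simp)
  have hker : LinearMap.ker π ≤ LinearMap.ker b := by
    rw [← hσ]
    rintro _ ⟨v, rfl⟩
    simpa using hb' 0 v
  refine ⟨(LinearMap.ker π).liftQ b hker ∘ₗ
    (π.quotKerEquivOfSurjective hπ).symm.toLinearMap, ?_⟩
  have h1 : (π.quotKerEquivOfSurjective hπ).symm x₀ = (LinearMap.ker π).mkQ q₀ := by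
    rw [LinearEquiv.symm_apply_eq]; exact hq₀.symm
  rw [LinearMap.comp_apply, LinearEquiv.coe_coe, h1]
  have h2 := hb' 1 0
  rw [one_smul, map_zero, add_zero, one_smul] at h2
  exact h2

end Extension

end TorsionModule

/-! ### The equivalence -/

open TorsionModule in
theorem proposition5p3 {K : Type w} [Field K] [IsAlgClosed K]
    {Λ : Type u} [Ring Λ] [Algebra K Λ] [FiniteDimensional K Λ]
    (T F : ObjectProperty (ModuleCat.{u} Λ)) (hTF : TorsionModule.IsTorsionPair T F) :
    List.TFAE [
      ∃ M : ModuleCat.{u} Λ, TorsionModule.finDim K Λ M ∧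
        T ⊓ TorsionModule.finDim K Λ = TorsionModule.smallGen M,
      ∃ M : ModuleCat.{u} Λ, TorsionModule.finDim K Λ M ∧
        T = TorsionModule.bigGen M ∧ F = TorsionModule.rightPerp M,
      TorsionModule.ClosedUnderProducts T ∧ TorsionModule.ClosedUnderDirectLimits F] := by
  have : IsArtinianRing Λ := isArtinian_of_tower K inferInstance
  have : IsNoetherianRing Λ := isNoetherian_of_tower K inferInstance
  tfae_have 1 → 2 := by
    rintro ⟨M, hM, hgen⟩
    have : Module.Finite Λ M := (finDim_iff M).1 hM
    have hMT : T M := by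
      have : smallGen M M := ⟨1, Finsupp.lapply 0, fun m => ⟨Finsupp.single 0 m, by simp⟩⟩
      rw [← hgen] at this
      exact this.1
    obtain ⟨d, m₀, hm₀⟩ := exists_isPointedGenerator K M
    have hpow : smallGen M (ModuleCat.of Λ (Fin d → M)) :=
      ⟨d, (Finsupp.linearEquivFunOnFinite Λ M (Fin d)).toLinearMap, LinearEquiv.surjective _⟩
    obtain ⟨X₀, x₀, hfin, hX₀, hX₀gen, hmin⟩ := hTF.exists_minimal_isPointedGenerator
      ⟨ModuleCat.of Λ (Fin d → M), m₀, inferInstanceAs (Module.Finite Λ (Fin d → M)),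
        (hgen ▸ hpow : (T ⊓ finDim K Λ) _).1, fun X hXfin hXT => by
          have hX : (T ⊓ finDim K Λ) X := ⟨hXT, (finDim_iff X).2 hXfin⟩
          rw [hgen] at hX
          exact hm₀ X (smallGen_le_bigGen _ hX)⟩
    have hX₀M : bigGen M X₀ := by
      have hX : (T ⊓ finDim K Λ) X₀ := ⟨hX₀, (finDim_iff X₀).2 hfin⟩
      rw [hgen] at hX
      exact smallGen_le_bigGen _ hX
    have hT : T = bigGen M := by
      refine le_antisymm (fun X hX => ?_) (hTF.bigGen_le hMT)
      have hgenX := hTF.isPointedGenerator_of_minimal K hX₀ hX₀gen hmin hX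
      rw [bigGen_iff_iSup_range, eq_top_iff] at hX₀M ⊢
      intro x _
      obtain ⟨f, rfl⟩ := hgenX x
      -- X₀ is a sum of images of M, so f carries x₀ into the sum of the images of M in X.
      have h1 := Submodule.mem_map_of_mem (f := f) (hX₀M (Submodule.mem_top (x := x₀)))
      rw [Submodule.map_iSup] at h1
      refine (iSup_le fun g => ?_ : _ ≤ (_ : Submodule Λ X)) h1
      rw [← LinearMap.range_comp]
      exact le_iSup (fun f : M →ₗ[Λ] X => LinearMap.range f) (f ∘ₗ g)
    exact ⟨M, hM, hT, hTF.eq_rightPerp hT⟩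
  tfae_have 2 → 1 := by
    rintro ⟨M, hM, hT, -⟩
    have : Module.Finite Λ M := (finDim_iff M).1 hM
    refine ⟨M, hM, le_antisymm ?_ ?_⟩
    · rintro N ⟨hN, hNfin⟩
      have : Module.Finite Λ N := (finDim_iff N).1 hNfin
      exact smallGen_of_bigGen (hT ▸ hN)
    · intro N hN
      exact ⟨hT ▸ smallGen_le_bigGen N hN, (finDim_iff N).2 (finite_of_smallGen hN)⟩
  tfae_have 2 → 3 := by
    rintro ⟨M, hM, hT, hF⟩
    have : Module.Finite Λ M := (finDim_iff M).1 hM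
    have : (bigGen M).IsClosedUnderIsomorphisms := hT ▸ hTF.closedUnderIso_torsion
    exact ⟨hT ▸ closedUnderProducts_bigGen K M, hF ▸ closedUnderDirectLimits_rightPerp M⟩
  tfae_have 3 → 2 := by
    rintro ⟨hT, hF⟩
    obtain ⟨M, m₀, hM, hMT, hgen⟩ := hTF.exists_fg_isPointedGenerator hT hF
    have hT' : T = bigGen M :=
      le_antisymm (fun X hX => (hgen X hX).bigGen) (hTF.bigGen_le hMT)
    exact ⟨M, (finDim_iff M).2 hM, hT', hTF.eq_rightPerp hT'⟩
  tfae_finish
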